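/- Let $p$ be a prime number, let $G$ be a pro-$p$ group (not necessarily finitely generated), and let $\Delta$ be a finite (discrete) group of order prime to $p$ acting continuously on $G$ by group automorphisms. Let $$1\to R\to F\xrightarrow{\ \pi\ } G\to 1$$ be a minimal presentation of $G$ by a free pro-$p$ group $F$; that is, $F$ is a free pro-$p$ group on a set of generators converging to $1$, $\pi$ is a continuous surjective homomorphism with kernel $R$, and $R\subseteq\overline{F^p[F,F]}$. Then there exists a continuous action of $\Delta$ on $F$ by group automorphisms such that $\pi(\sigma x)=\sigma\,\pi(x)$ for all $\sigma\in\Delta$ and $x\in F$. -/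

import Mathlib

open Filter Topology

universe u v w

/-- A profinite group `G` (a compact, totally disconnected topological group) is pro-`p` if every
open normal subgroup has `p`-power index. -/
def IsProP (p : ℕ) (G : Type u) [Group G] [TopologicalSpace G] [IsTopologicalGroup G]
    [CompactSpace G] [TotallyDisconnectedSpace G] : Prop :=
  ∀ U : Subgroup G, U.Normal → IsOpen (U : Set G) → ∃ n : ℕ, U.index = p ^ n

/-- A family `ι : X → F` converging to `1` (every neighbourhood of `1` contains `ι x` for all but
finitely many `x`) is a basis of the pro-`p` group `F` if every family `X → H` in a pro-`p` group
`H` that converges to `1` extends to a unique continuous homomorphism `F → H`. -/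
structure IsFreeProPBasis (p : ℕ) {F : Type u} [Group F] [TopologicalSpace F]
    [IsTopologicalGroup F] [CompactSpace F] [TotallyDisconnectedSpace F]
    {X : Type w} (ι : X → F) : Prop where
  tendsto_one : Tendsto ι cofinite (𝓝 1)
  existsUnique_lift : ∀ (H : Type u) [Group H] [TopologicalSpace H] [IsTopologicalGroup H]
    [CompactSpace H] [TotallyDisconnectedSpace H], IsProP p H →
    ∀ f : X → H, Tendsto f cofinite (𝓝 1) → ∃! φ : F →ₜ* H, ∀ x, φ (ι x) = f x

/-- `F` is a free pro-`p` group (of arbitrary, possibly infinite, rank): it is pro-`p` and has a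
basis. A basis is an injective family, so index types in the universe of `F` suffice. -/
def IsFreeProP (p : ℕ) (F : Type u) [Group F] [TopologicalSpace F] [IsTopologicalGroup F]
    [CompactSpace F] [TotallyDisconnectedSpace F] : Prop :=
  IsProP p F ∧ ∃ (X : Type u) (ι : X → F), IsFreeProPBasis p ι

/-- The subgroup `closure (Fᵖ [F, F])` of a topological group; for a pro-`p` group it is the
Frattini subgroup. -/
def proPFrattini (p : ℕ) (F : Type u) [Group F] [TopologicalSpace F] [IsTopologicalGroup F] :
    Subgroup F :=
  (Subgroup.closure (Set.range fun x : F => x ^ p) ⊔ commutator F).topologicalClosure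

/-- `1 → ker π → F → G → 1` is a minimal presentation of `G` by a free pro-`p` group: `F` is free
pro-`p`, `π` is a continuous surjection, and `ker π` lies in the Frattini subgroup of `F`, i.e. `π`
induces an isomorphism of `F / closure (Fᵖ [F, F])` with `G / closure (Gᵖ [G, G])`. -/
structure IsMinimalProPPresentation (p : ℕ) {F : Type u} {G : Type v}
    [Group F] [TopologicalSpace F] [IsTopologicalGroup F] [CompactSpace F]
    [TotallyDisconnectedSpace F] [Group G] [TopologicalSpace G] (π : F →ₜ* G) : Prop where
  free : IsFreeProP p F
  surjective : Function.Surjective π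
  ker_le : π.toMonoidHom.ker ≤ proPFrattini p F

/-! Free pro-`p` groups are projective, so each `σ` lifts through `π` to an endomorphism `a σ` of
`F`, and `a` is multiplicative modulo `R = ker π`. The failure is repaired along `N 0 = R`, `N (n+1)
= closure (N n ^ p [N n, F])`. Each layer `N n / N (n+1)` is central of exponent `p`, so the defect
is a 2-cocycle of `Δ` in the group of continuous homomorphisms from `F` to the layer, which has
exponent `p`. Minimality enters here: such homomorphisms kill the Frattini subgroup, which contains
`R`, so precomposition with the `a σ` is a genuine right action. As `|Δ|` is prime to `p`, averaging
splits the cocycle (`exists_splitting_of_coprime`), and projectivity realises the correction by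
endomorphisms (`IsFreeProP.exists_lift_action_step`). The series shrinks to `1`, so the corrections
converge to an action. -/

open scoped IsMulCommutative commutatorElement

/-! ### Permanence properties of pro-`p` groups. -/

section ProP

variable {p : ℕ} {G : Type*} [Group G] [TopologicalSpace G] [IsTopologicalGroup G]
  [CompactSpace G] [TotallyDisconnectedSpace G]

theorem exists_normal_isOpen_le_of_mem_nhds {W : Set G} (hW : W ∈ 𝓝 (1 : G)) :
    ∃ U : Subgroup G, U.Normal ∧ IsOpen (U : Set G) ∧ (U : Set G) ⊆ W := by
  obtain ⟨W', h1, h2, h3⟩ := mem_nhds_iff.mp hW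
  obtain ⟨H, hH⟩ := ProfiniteGrp.exist_openNormalSubgroup_sub_open_nhds_of_one h2 h3
  exact ⟨H.toSubgroup, H.isNormal', H.isOpen', hH.trans h1⟩

theorem exists_normal_isOpen_notMem {x : G} (hx : x ≠ 1) :
    ∃ U : Subgroup G, U.Normal ∧ IsOpen (U : Set G) ∧ x ∉ U := by
  obtain ⟨U, h1, h2, h3⟩ := exists_normal_isOpen_le_of_mem_nhds (isOpen_ne.mem_nhds hx.symm)
  exact ⟨U, h1, h2, fun h => h3 h rfl⟩

theorem isProP_of_index_dvd (hp : p.Prime)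
    (h : ∀ W ∈ 𝓝 (1 : G), ∃ U : Subgroup G, (U : Set G) ⊆ W ∧ ∃ n, U.index ∣ p ^ n) :
    IsProP p G := by
  intro U _ hU
  obtain ⟨V, hV, n, hn⟩ := h U (hU.mem_nhds U.one_mem)
  obtain ⟨k, -, hk⟩ := (Nat.dvd_prime_pow hp).1 ((Subgroup.index_dvd_of_le hV).trans hn)
  exact ⟨k, hk⟩

theorem IsProP.subgroup (hp : p.Prime) (hG : IsProP p G) (S : Subgroup G) [CompactSpace S] :
    IsProP p S := by
  refine isProP_of_index_dvd hp fun W hW => ?_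
  obtain ⟨W', hW', h⟩ := mem_nhds_induced _ _ _ |>.1 hW
  obtain ⟨V, hVn, hVo, hV⟩ := exists_normal_isOpen_le_of_mem_nhds hW'
  obtain ⟨n, hn⟩ := hG V hVn hVo
  exact ⟨V.subgroupOf S, fun x hx => h (hV hx), n,
    hn ▸ Subgroup.relIndex_dvd_index_of_normal V S⟩

theorem IsProP.prod {H : Type*} [Group H] [TopologicalSpace H] [IsTopologicalGroup H]
    [CompactSpace H] [TotallyDisconnectedSpace H] (hp : p.Prime) (hG : IsProP p G)
    (hH : IsProP p H) : IsProP p (G × H) := by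
  refine isProP_of_index_dvd hp fun W hW => ?_
  obtain ⟨A, hA, B, hB, hAB⟩ := mem_nhds_prod_iff.1 hW
  obtain ⟨U, hUn, hUo, hU⟩ := exists_normal_isOpen_le_of_mem_nhds hA
  obtain ⟨V, hVn, hVo, hV⟩ := exists_normal_isOpen_le_of_mem_nhds hB
  obtain ⟨m, hm⟩ := hG U hUn hUo
  obtain ⟨n, hn⟩ := hH V hVn hVo
  refine ⟨U.prod V, fun x hx => hAB ⟨hU hx.1, hV hx.2⟩, m + n, ?_⟩
  rw [Subgroup.index_prod, hm, hn, pow_add]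

theorem IsProP.quotient (hp : p.Prime) (hG : IsProP p G) (U : Subgroup G) [U.Normal]
    (hU : IsOpen (U : Set G)) [TotallyDisconnectedSpace (G ⧸ U)] : IsProP p (G ⧸ U) := by
  refine isProP_of_index_dvd hp fun W hW => ?_
  refine ⟨⊥, by simpa using mem_of_mem_nhds hW, ?_⟩
  obtain ⟨n, hn⟩ := hG U inferInstance hU
  exact ⟨n, by rw [Subgroup.index_bot]; exact hn.dvd⟩

end ProP

/-! ### Projectivity of free pro-`p` groups. -/

section Projective

/-- A continuous surjection from a compact group has a minimal closed subgroup of its source that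
still surjects. -/
theorem exists_minimal_closed_subgroup_surjOn {P F : Type*} [Group P] [TopologicalSpace P]
    [CompactSpace P] [Group F] [TopologicalSpace F] [T1Space F] (q : P →ₜ* F)
    (hq : Function.Surjective q) :
    ∃ S : Subgroup P, IsClosed (S : Set P) ∧ q '' S = Set.univ ∧
      ∀ T : Subgroup P, T ≤ S → IsClosed (T : Set P) → q '' T = Set.univ → T = S := by
  let 𝒮 : Set (Set P) := {A | ∃ S : Subgroup P, (S : Set P) = A ∧ IsClosed A ∧ q '' A = Set.univ}
  obtain ⟨m, -, ⟨⟨S, rfl, h1, h2⟩, h3⟩⟩ := zorn_superset_nonempty 𝒮 (by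
    intro c hc hchain hne
    refine ⟨⋂₀ c, ?_, fun s hs => Set.sInter_subset_of_mem hs⟩
    have hcl : ∀ A ∈ c, IsClosed A := fun A hA => (hc hA).choose_spec.2.1
    refine ⟨sInf {S : Subgroup P | (S : Set P) ∈ c}, ?_, isClosed_sInter hcl, ?_⟩
    · ext x
      simp only [Subgroup.coe_sInf, Set.mem_ofPred_eq, Set.mem_iInter, Set.mem_sInter]
      constructor
      · intro h A hA
        obtain ⟨S, rfl, -⟩ := hc hA
        exact h S hA
      · exact fun h S hS => h _ hS
    · rw [Set.eq_univ_iff_forall]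
      intro y
      have : Nonempty c := hne.to_subtype
      have hyc : IsClosed (q ⁻¹' {y}) := isClosed_singleton.preimage q.continuous_toFun
      -- Compactness of the fibre over `y` keeps the intersection of the chain surjective.
      obtain ⟨x, hx⟩ := IsCompact.nonempty_iInter_of_directed_nonempty_isCompact_isClosed
        (fun A : c => (A : Set P) ∩ q ⁻¹' {y})
        (by
          intro A B
          rcases hchain.total A.2 B.2 with h | h
          · exact ⟨A, subset_rfl, Set.inter_subset_inter_left _ h⟩
          · exact ⟨B, Set.inter_subset_inter_left _ h, subset_rfl⟩)
        (by
          intro A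
          obtain ⟨-, -, -, h⟩ := hc A.2
          obtain ⟨x, hx, hxy⟩ := h.symm ▸ Set.mem_univ y
          exact ⟨x, hx, hxy⟩)
        (fun A => ((hcl A A.2).inter hyc).isCompact)
        (fun A => (hcl A A.2).inter hyc)
      rw [Set.mem_iInter] at hx
      exact ⟨x, fun A hA => (hx ⟨A, hA⟩).1, (hx (Classical.arbitrary c)).2⟩)
    Set.univ ⟨⊤, rfl, isClosed_univ, by simpa using hq.range_eq⟩
  refine ⟨S, h1, h2, fun T hT hTc hTs => SetLike.coe_injective ?_⟩
  exact Set.Subset.antisymm hT (h3 ⟨T, rfl, hTc, hTs⟩ hT)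
variable {p : ℕ} {F : Type u} [Group F] [TopologicalSpace F] [IsTopologicalGroup F]
  [CompactSpace F] [TotallyDisconnectedSpace F]
  {P : Type u} [Group P] [TopologicalSpace P] [IsTopologicalGroup P]
  [CompactSpace P] [TotallyDisconnectedSpace P]

/-- Finiteness of the kernel gives an open `V` meeting it trivially, so `q` is injective on `V`.
Choosing preimages of basis elements in `V` whenever possible forces them to converge to `1`. -/
theorem IsFreeProP.exists_section_of_finite_ker (hF : IsFreeProP p F) (hP : IsProP p P)
    (q : P →ₜ* F) (hq : Function.Surjective q) (hk : {x | q x = 1}.Finite) :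
    ∃ s : F →ₜ* P, ∀ x, q (s x) = x := by
  obtain ⟨hFp, X, ι, hι⟩ := hF
  have hopen : IsOpenMap q :=
    MonoidHom.isOpenMap_of_sigmaCompact (q : P →* F) hq q.continuous_toFun
  have hW : ({x | q x = 1} \ {1})ᶜ ∈ 𝓝 (1 : P) :=
    (hk.subset Set.sdiff_subset).isClosed.isOpen_compl.mem_nhds (by simp)
  obtain ⟨V, -, hVo, hV⟩ := exists_normal_isOpen_le_of_mem_nhds hW
  have hg : ∀ x, ∃ y, q y = ι x ∧ ((∃ v ∈ V, q v = ι x) → y ∈ V) := by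
    intro x
    by_cases h : ∃ v ∈ V, q v = ι x
    · obtain ⟨v, hv, hx⟩ := h
      exact ⟨v, hx, fun _ => hv⟩
    · obtain ⟨y, hy⟩ := hq (ι x)
      exact ⟨y, hy, fun h' => absurd h' h⟩
  choose g hgq hgV using hg
  have hlim : Tendsto g cofinite (𝓝 1) := by
    intro W hW
    have h1 : q '' (W ∩ V) ∈ 𝓝 (1 : F) := by
      rw [← map_one q]
      exact hopen.image_mem_nhds (inter_mem hW (hVo.mem_nhds V.one_mem))
    have h0 : ∀ᶠ x in cofinite, ι x ∈ q '' (W ∩ V) := hι.tendsto_one h1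
    change ∀ᶠ x in cofinite, g x ∈ W
    filter_upwards [h0] with x hx
    obtain ⟨v, ⟨hvW, hvV⟩, hv⟩ := hx
    have hgx := hgV x ⟨v, hvV, hv⟩
    have h2 := hV (V.mul_mem hgx (V.inv_mem hvV))
    have h3 : g x * v⁻¹ = 1 := by
      by_contra h
      exact h2 ⟨by simp [hgq, hv], h⟩
    rw [mul_inv_eq_one] at h3
    rwa [h3]
  obtain ⟨s, hs, -⟩ := hι.existsUnique_lift P hP g hlim
  refine ⟨s, fun x => ?_⟩
  have := (hι.existsUnique_lift F hFp ι hι.tendsto_one).unique (y₁ := q.comp s)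
    (y₂ := ContinuousMonoidHom.id F) (fun x => by simp [hs, hgq]) (fun x => rfl)
  exact DFunLike.congr_fun this x

/-- Free pro-`p` groups are projective: continuous surjections from pro-`p` groups split. -/
theorem IsFreeProP.exists_section (hp : p.Prime) (hF : IsFreeProP p F) (hP : IsProP p P)
    (q : P →ₜ* F) (hq : Function.Surjective q) : ∃ s : F →ₜ* P, ∀ x, q (s x) = x := by
  obtain ⟨S, hSc, hSs, hmin⟩ := exists_minimal_closed_subgroup_surjOn q hq
  have : CompactSpace S := isCompact_iff_compactSpace.1 hSc.isCompact
  have hS := hP.subgroup hp S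
  let i : S →ₜ* P := ⟨S.subtype, continuous_subtype_val⟩
  let r : S →ₜ* F := q.comp i
  have hr : Function.Surjective r := by
    intro y
    obtain ⟨x, hx, hxy⟩ := hSs.symm ▸ Set.mem_univ y
    exact ⟨⟨x, hx⟩, hxy⟩
  -- If `k ≠ 1` lies in the kernel, pick `U` missing `k`. The image `B` of `S` in `F × S/U` has
  -- finite kernel over `F`, hence a section `s`; the preimage `T` of its range still surjects onto
  -- `F`, so `T = S` by minimality. Then `f' k = s 1 = 1`, forcing `k ∈ U`.
  have hinj : Function.Injective r := by
    rw [injective_iff_map_eq_one]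
    intro k hk
    by_contra hk1
    obtain ⟨U, hUn, hUo, hkU⟩ := exists_normal_isOpen_notMem hk1
    have : DiscreteTopology (S ⧸ U) := QuotientGroup.discreteTopology hUo
    have : Finite (S ⧸ U) := U.quotient_finite_of_isOpen hUo
    let f : S →ₜ* F × (S ⧸ U) := r.prod ⟨QuotientGroup.mk' U, continuous_quot_mk⟩
    let B : Subgroup (F × (S ⧸ U)) := f.toMonoidHom.range
    have hBc : IsClosed (B : Set (F × (S ⧸ U))) := (isCompact_range f.continuous_toFun).isClosed
    have : CompactSpace B := isCompact_iff_compactSpace.1 hBc.isCompact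
    have hB : IsProP p B := (hF.1.prod hp (hS.quotient hp U hUo)).subgroup hp B
    let t : B →ₜ* F := (ContinuousMonoidHom.fst F (S ⧸ U)).comp ⟨B.subtype, continuous_subtype_val⟩
    obtain ⟨s, hs⟩ := hF.exists_section_of_finite_ker hB t
      (fun y => by
        obtain ⟨x, rfl⟩ := hr y
        exact ⟨⟨f x, x, rfl⟩, rfl⟩)
      (Set.Finite.of_injOn (f := fun b : B => b.1.2) (t := Set.univ) (fun _ _ => Set.mem_univ _)
        (by
          rintro b hb b' hb' h
          exact Subtype.ext (Prod.ext (Eq.trans hb (Eq.symm hb')) h)) Set.finite_univ)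
    let f' : S →ₜ* B := ⟨f.toMonoidHom.rangeRestrict, f.continuous_toFun.subtype_mk _⟩
    let T : Subgroup S := s.toMonoidHom.range.comap f'.toMonoidHom
    have hTc : IsClosed (T : Set S) :=
      (isCompact_range s.continuous_toFun).isClosed.preimage f'.continuous_toFun
    have hTS : T.map S.subtype = S := by
      refine hmin _ (Subgroup.map_subtype_le T) ?_ ?_
      · exact hSc.isClosedEmbedding_subtypeVal.isClosedMap _ hTc
      · rw [Set.eq_univ_iff_forall]
        intro y
        obtain ⟨x, hx⟩ := (s y).2
        refine ⟨x, ⟨x, ⟨y, Subtype.ext hx.symm⟩, rfl⟩, ?_⟩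
        have h1 : f x = (s y).1 := hx
        have h2 : (f x).1 = y := by rw [h1]; exact hs y
        exact h2
    have hkT : k ∈ T := by
      obtain ⟨k', hk', h⟩ : (k : P) ∈ T.map S.subtype := by rw [hTS]; exact k.2
      rwa [← Subtype.ext h]
    obtain ⟨y, hy⟩ := hkT
    have hy' : s y = f' k := hy
    have hy1 : y = 1 := by rw [← hs y, hy']; exact hk
    rw [hy1, map_one] at hy'
    exact hkU ((QuotientGroup.eq_one_iff k).1 (congrArg (fun b : B => b.1.2) hy').symm)
  let e : S ≃* F := MulEquiv.ofBijective r.toMonoidHom ⟨hinj, hr⟩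
  have he : Continuous e.symm :=
    (Continuous.homeoOfEquivCompactToT2 (f := e.toEquiv) r.continuous_toFun).symm.continuous
  exact ⟨i.comp ⟨e.symm.toMonoidHom, he⟩, fun x => e.apply_symm_apply x⟩

/-- A section of the first projection of the fibre product `B` of `f` and `q`, followed by the
second projection, is the lift. -/
theorem IsFreeProP.exists_lift (hp : p.Prime) (hF : IsFreeProP p F) {C : Type*} [Group C]
    [TopologicalSpace C] [T2Space C] (f q : F →ₜ* C) (hq : Function.Surjective q) :
    ∃ g : F →ₜ* F, ∀ x, q (g x) = f x := by
  let B : Subgroup (F × F) := (f.comp (.fst F F)).toMonoidHom.eqLocus (q.comp (.snd F F)).toMonoidHom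
  have hBc : IsClosed (B : Set (F × F)) :=
    isClosed_eq (f.comp (.fst F F)).continuous_toFun (q.comp (.snd F F)).continuous_toFun
  have : CompactSpace B := isCompact_iff_compactSpace.1 hBc.isCompact
  let i : B →ₜ* F × F := ⟨B.subtype, continuous_subtype_val⟩
  obtain ⟨s, hs⟩ := hF.exists_section hp ((hF.1.prod hp hF.1).subgroup hp B)
    ((ContinuousMonoidHom.fst F F).comp i) (fun x => by
      obtain ⟨y, hy⟩ := hq (f x)
      exact ⟨⟨(x, y), hy.symm⟩, rfl⟩)
  refine ⟨(ContinuousMonoidHom.snd F F).comp (i.comp s), fun x => ?_⟩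
  have h : f (s x).1.1 = q (s x).1.2 := (s x).2
  have h' : (s x).1.1 = x := hs x
  rw [h'] at h
  exact h.symm

end Projective

/-! ### Vanishing of cohomology in coprime exponent. -/

section Averaging

/-- Averaging: a 2-cocycle of a finite group with values in a bimodule of coprime exponent is a
coboundary. -/
theorem exists_splitting_of_coprime {p : ℕ} (hp : 1 < p) {Δ K : Type*} [Group Δ] [Finite Δ] [CommGroup K]
    (hΔ : (Nat.card Δ).Coprime p) (hK : ∀ k : K, k ^ p = 1) (L R : Δ → K →* K) (c : Δ → Δ → K)
    (hR : ∀ σ τ k, R τ (R σ k) = R (σ * τ) k) (hR1 : ∀ k, R 1 k = k)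
    (hLR : ∀ σ τ k, L σ (R τ k) = R τ (L σ k))
    (hc : ∀ σ τ ρ, L σ (c τ ρ) * c σ (τ * ρ) = R ρ (c σ τ) * c (σ * τ) ρ) :
    ∃ b : Δ → K, ∀ σ τ, b (σ * τ) = R τ (b σ) * L σ (b τ) * c σ τ := by
  have := Fintype.ofFinite Δ
  -- Applying `R ρ⁻¹` to the cocycle identity and multiplying over `ρ` exhibits `c ^ |Δ|` as a
  -- coboundary; inverting `|Δ|` modulo `p` then removes the exponent.
  let e : Δ → K := fun σ => ∏ ρ, R ρ⁻¹ (c σ ρ)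
  have he (σ τ : Δ) : L σ (e τ) * R τ (e σ) = c σ τ ^ Nat.card Δ * e (σ * τ) := by
    have h1 : R τ (e σ) = ∏ ρ, R ρ⁻¹ (c σ (τ * ρ)) := by
      rw [← Equiv.prod_comp (Equiv.mulLeft τ⁻¹), map_prod]
      exact Finset.prod_congr rfl fun ρ _ => by simp [hR]
    rw [h1, map_prod, ← Finset.prod_mul_distrib, Nat.card_eq_fintype_card, ← Finset.card_univ,
      ← Finset.prod_const, ← Finset.prod_mul_distrib]
    refine Finset.prod_congr rfl fun ρ _ => ?_
    rw [hLR, ← map_mul, hc, map_mul, hR, mul_inv_cancel, hR1]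
  obtain ⟨m, -, hm⟩ := Nat.exists_mul_mod_eq_one_of_coprime hΔ hp
  have hpow (k : K) : (k ^ Nat.card Δ) ^ m = k := by
    rw [← pow_mul, ← Nat.mod_add_div (_ * m) p, pow_add, pow_mul _ p, hK, one_pow, mul_one, hm,
      pow_one]
  refine ⟨fun σ => (e σ ^ m)⁻¹, fun σ τ => ?_⟩
  have h2 : c σ τ = (L σ (e τ) * R τ (e σ)) ^ m * (e (σ * τ) ^ m)⁻¹ := by
    rw [he, mul_pow, hpow, mul_inv_cancel_right]
  rw [h2, map_inv, map_inv, map_pow, map_pow, mul_pow, ← mul_inv, mul_comm (R τ _ ^ m), ← mul_assoc,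
    inv_mul_cancel, one_mul]

end Averaging

/-! ### Correcting the action across one central layer. -/

section Layer

theorem mul_inv_mem_iff_mk_eq {F : Type*} [Group F] {M : Subgroup F} [M.Normal] {x y : F} :
    x * y⁻¹ ∈ M ↔ (x : F ⧸ M) = y := by
  rw [← QuotientGroup.eq_one_iff, QuotientGroup.mk_mul, QuotientGroup.mk_inv, mul_inv_eq_one]

variable {p : ℕ} {F : Type u} [Group F] [TopologicalSpace F] [IsTopologicalGroup F]

/-- The smallest closed normal subgroup containing `Nᵖ` and `[N, F]`. -/
def frattiniStep (p : ℕ) (N : Subgroup F) : Subgroup F :=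
  (Subgroup.normalClosure
    ((fun n => n ^ p) '' (N : Set F) ∪ {y | ∃ n ∈ N, ∃ x, y = ⁅n, x⁆})).topologicalClosure

instance frattiniStep_normal (N : Subgroup F) : (frattiniStep p N).Normal :=
  Subgroup.is_normal_topologicalClosure _

theorem isClosed_frattiniStep (N : Subgroup F) : IsClosed (frattiniStep p N : Set F) :=
  Subgroup.isClosed_topologicalClosure _

theorem pow_mem_frattiniStep {N : Subgroup F} {n : F} (hn : n ∈ N) : n ^ p ∈ frattiniStep p N :=
  Subgroup.le_topologicalClosure _ (Subgroup.subset_normalClosure (.inl ⟨n, hn, rfl⟩))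

theorem commutator_mem_frattiniStep {N : Subgroup F} {n : F} (hn : n ∈ N) (x : F) :
    ⁅n, x⁆ ∈ frattiniStep p N :=
  Subgroup.le_topologicalClosure _ (Subgroup.subset_normalClosure (.inr ⟨n, hn, x, rfl⟩))

theorem frattiniStep_le {N L : Subgroup F} [L.Normal] (hL : IsClosed (L : Set F))
    (hpow : ∀ n ∈ N, n ^ p ∈ L) (hcomm : ∀ n ∈ N, ∀ x, ⁅n, x⁆ ∈ L) : frattiniStep p N ≤ L := by
  refine Subgroup.topologicalClosure_minimal _ (Subgroup.normalClosure_le_normal ?_) hL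
  rintro _ (⟨n, hn, rfl⟩ | ⟨n, hn, x, rfl⟩)
  exacts [hpow n hn, hcomm n hn x]

theorem frattiniStep_le_self {N : Subgroup F} [N.Normal] (hN : IsClosed (N : Set F)) :
    frattiniStep p N ≤ N :=
  frattiniStep_le hN (fun _ hn => N.pow_mem hn p)
    fun n hn x => by
      rw [commutatorElement_def, mul_assoc, mul_assoc, ← mul_assoc x]
      exact N.mul_mem hn (‹N.Normal›.conj_mem _ (N.inv_mem hn) x)

theorem frattiniStep_le_comap {N : Subgroup F} (f : F →ₜ* F) (hf : ∀ n ∈ N, f n ∈ N) :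
    ∀ n ∈ frattiniStep p N, f n ∈ frattiniStep p N := by
  have : frattiniStep p N ≤ (frattiniStep p N).comap f.toMonoidHom :=
    frattiniStep_le ((isClosed_frattiniStep N).preimage f.continuous_toFun)
      (fun n hn => by
        simpa using pow_mem_frattiniStep (p := p) (hf n hn))
      (fun n hn x => by
        simpa [map_commutatorElement] using commutator_mem_frattiniStep (p := p) (hf n hn) (f x))
  exact this

/-- The image of `N` in `F ⧸ frattiniStep p N`, a central subgroup of exponent `p`. -/
abbrev layer (p : ℕ) (N : Subgroup F) : Subgroup (F ⧸ frattiniStep p N) :=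
  N.map (QuotientGroup.mk' _)

variable {N : Subgroup F}

theorem mk_mem_layer_iff [N.Normal] (hN : IsClosed (N : Set F)) {x : F} :
    (x : F ⧸ frattiniStep p N) ∈ layer p N ↔ x ∈ N := by
  refine ⟨?_, fun hx => ⟨x, hx, rfl⟩⟩
  rintro ⟨y, hy, h⟩
  have := frattiniStep_le_self hN (mul_inv_mem_iff_mk_eq.2 h.symm)
  simpa using N.mul_mem this hy

theorem layer_comm {a : F ⧸ frattiniStep p N} (ha : a ∈ layer p N) (b : F ⧸ frattiniStep p N) :
    a * b = b * a := by
  obtain ⟨n, hn, rfl⟩ := ha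
  obtain ⟨x, rfl⟩ := QuotientGroup.mk_surjective b
  rw [← commutatorElement_eq_one_iff_mul_comm]
  exact (QuotientGroup.eq_one_iff _).2 (commutator_mem_frattiniStep hn x)

instance layer_isMulCommutative : IsMulCommutative (layer p N) :=
  ⟨⟨fun a b => Subtype.ext (layer_comm a.2 b)⟩⟩

theorem layer_pow (a : layer p N) : a ^ p = 1 := by
  obtain ⟨_, n, hn, rfl⟩ := a
  exact Subtype.ext ((QuotientGroup.eq_one_iff _).2 (pow_mem_frattiniStep hn))

/-- The layer is abelian of exponent `p` and Hausdorff, so the kernel of `k` is closed and contains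
all `p`-th powers and commutators. -/
theorem eq_one_of_mem_proPFrattini (k : F →ₜ* layer p N) {x : F} (hx : x ∈ proPFrattini p F) :
    k x = 1 := by
  have := (QuotientGroup.instT3Space (frattiniStep p N) (hN := isClosed_frattiniStep N))
  have hle : proPFrattini p F ≤ k.toMonoidHom.ker := by
    refine Subgroup.topologicalClosure_minimal _ (sup_le ?_ ?_)
      (isClosed_singleton.preimage k.continuous_toFun)
    · rw [Subgroup.closure_le]
      rintro _ ⟨y, rfl⟩
      exact (map_pow k y p).trans (layer_pow _)
    · exact Abelianization.commutator_subset_ker k.toMonoidHom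
  exact hle hx

theorem apply_eq_of_mul_inv_mem (k : F →ₜ* layer p N) {x y : F}
    (h : x * y⁻¹ ∈ proPFrattini p F) : k x = k y := by
  have := eq_one_of_mem_proPFrattini k h
  rwa [map_mul, map_inv, mul_inv_eq_one] at this

/-- The quotient of two endomorphisms congruent modulo `N`, as a homomorphism to `layer p N`. -/
def diffHom (p : ℕ) (f g : F →ₜ* F) (h : ∀ x, f x * (g x)⁻¹ ∈ N) : F →ₜ* layer p N where
  toFun x := ⟨(f x * (g x)⁻¹ : F), _, h x, rfl⟩
  map_one' := Subtype.ext (by simp)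
  map_mul' x y := Subtype.ext (by
    have := layer_comm (p := p) ⟨_, h y, rfl⟩ ((g x)⁻¹ : F)
    simp only [QuotientGroup.mk'_apply, QuotientGroup.mk_mul, QuotientGroup.mk_inv] at this
    simp only [map_mul, mul_inv_rev, QuotientGroup.mk_mul, QuotientGroup.mk_inv,
      Subgroup.coe_mul, mul_assoc] at this ⊢
    rw [this])
  continuous_toFun := (continuous_quot_mk.comp
    (f.continuous_toFun.mul g.continuous_toFun.inv)).subtype_mk _

theorem diffHom_mul (f g : F →ₜ* F) (h : ∀ x, f x * (g x)⁻¹ ∈ N) (x : F) :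
    (diffHom p f g h x : F ⧸ frattiniStep p N) * (g x : F) = (f x : F) := by
  change ((f x * (g x)⁻¹ : F) : F ⧸ frattiniStep p N) * (g x : F) = _
  rw [← QuotientGroup.mk_mul, inv_mul_cancel_right]

/-- The endomorphism of `F ⧸ frattiniStep p N` induced by `f`. -/
def mapQuotient (p : ℕ) (f : F →ₜ* F) (hf : ∀ n ∈ N, f n ∈ N) :
    F ⧸ frattiniStep p N →ₜ* F ⧸ frattiniStep p N where
  toMonoidHom := QuotientGroup.map _ _ f.toMonoidHom (frattiniStep_le_comap f hf)
  continuous_toFun := Continuous.quotient_lift (continuous_quot_mk.comp f.continuous_toFun) _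

theorem mapQuotient_mk (f : F →ₜ* F) (hf : ∀ n ∈ N, f n ∈ N) (x : F) :
    mapQuotient p f hf x = (f x : F) := rfl

theorem mapQuotient_mem_layer (f : F →ₜ* F) (hf : ∀ n ∈ N, f n ∈ N) {a : F ⧸ frattiniStep p N}
    (ha : a ∈ layer p N) : mapQuotient p f hf a ∈ layer p N := by
  obtain ⟨n, hn, rfl⟩ := ha
  exact ⟨f n, hf n hn, rfl⟩

/-- The endomorphism of `layer p N` induced by `f`. -/
def mapLayer (p : ℕ) (f : F →ₜ* F) (hf : ∀ n ∈ N, f n ∈ N) : layer p N →ₜ* layer p N where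
  toFun a := ⟨mapQuotient p f hf a, mapQuotient_mem_layer f hf a.2⟩
  map_one' := Subtype.ext (map_one _)
  map_mul' _ _ := Subtype.ext (map_mul _ _ _)
  continuous_toFun :=
    ((mapQuotient p f hf).continuous_toFun.comp continuous_subtype_val).subtype_mk _

theorem coe_mapLayer (f : F →ₜ* F) (hf : ∀ n ∈ N, f n ∈ N) (a : layer p N) :
    (mapLayer p f hf a : F ⧸ frattiniStep p N) = mapQuotient p f hf a := rfl

/-- Centrality of the layer makes the pointwise product a homomorphism, which projectivity lifts to
`F`. -/
theorem IsFreeProP.exists_mk_eq_mul [CompactSpace F] [TotallyDisconnectedSpace F]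
    (hp : p.Prime) (hF : IsFreeProP p F) (f : F →ₜ* F) (b : F →ₜ* layer p N) :
    ∃ g : F →ₜ* F, ∀ x, ((g x : F) : F ⧸ frattiniStep p N) = b x * (f x : F) := by
  have := (QuotientGroup.instT3Space (frattiniStep p N) (hN := isClosed_frattiniStep N))
  let φ : F →ₜ* F ⧸ frattiniStep p N :=
    { toFun x := b x * (f x : F)
      map_one' := by simp
      map_mul' x y := by
        rw [map_mul, map_mul, Subgroup.coe_mul, QuotientGroup.mk_mul]
        exact Commute.mul_mul_mul_comm (layer_comm (b y).2 (f x : F)) _ _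
      continuous_toFun := (continuous_subtype_val.comp b.continuous_toFun).mul
        (continuous_quot_mk.comp f.continuous_toFun) }
  exact hF.exists_lift hp φ ⟨QuotientGroup.mk' _, continuous_quot_mk⟩
    (QuotientGroup.mk'_surjective _)

/-- A lift of an action that is multiplicative modulo `N` can be modified modulo `N` to become
multiplicative modulo `frattiniStep p N`. -/
theorem IsFreeProP.exists_lift_action_step [CompactSpace F] [TotallyDisconnectedSpace F]
    [N.Normal] (hp : p.Prime) (hF : IsFreeProP p F) (hN : IsClosed (N : Set F))
    (hNF : N ≤ proPFrattini p F) {Δ : Type*} [Group Δ] [Finite Δ] (hΔ : (Nat.card Δ).Coprime p)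
    (a : Δ → F →ₜ* F) (haN : ∀ σ, ∀ n ∈ N, a σ n ∈ N)
    (ha1 : ∀ x, a 1 x * x⁻¹ ∈ proPFrattini p F)
    (ha : ∀ σ τ x, a σ (a τ x) * (a (σ * τ) x)⁻¹ ∈ N) :
    ∃ a' : Δ → F →ₜ* F, (∀ σ x, a' σ x * (a σ x)⁻¹ ∈ N) ∧
      ∀ σ τ x, a' σ (a' τ x) * (a' (σ * τ) x)⁻¹ ∈ frattiniStep p N := by
  let c (σ τ : Δ) : F →ₜ* layer p N := diffHom p ((a σ).comp (a τ)) (a (σ * τ)) (ha σ τ)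
  have hc (σ τ : Δ) (x : F) :
      (c σ τ x : F ⧸ frattiniStep p N) * (a (σ * τ) x : F) = (a σ (a τ x) : F) :=
    diffHom_mul ((a σ).comp (a τ)) (a (σ * τ)) (ha σ τ) x
  let L (σ : Δ) : (F →ₜ* layer p N) →* (F →ₜ* layer p N) :=
    (ContinuousMonoidHom.compRight F (mapLayer p (a σ) (haN σ))).toMonoidHom
  have hL (σ : Δ) (k : F →ₜ* layer p N) (x : F) : L σ k x = mapLayer p (a σ) (haN σ) (k x) := rfl
  let R (σ : Δ) : (F →ₜ* layer p N) →* (F →ₜ* layer p N) :=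
    (ContinuousMonoidHom.compLeft (layer p N) (a σ)).toMonoidHom
  have hR (σ : Δ) (k : F →ₜ* layer p N) (x : F) : R σ k x = k (a σ x) := rfl
  obtain ⟨b, hb⟩ := exists_splitting_of_coprime hp.one_lt hΔ
    (fun k => ContinuousMonoidHom.ext fun x =>
      (ContinuousMonoidHom.pow_apply k p x).trans (layer_pow _)) L R c
    (fun σ τ k => ContinuousMonoidHom.ext fun x => apply_eq_of_mul_inv_mem k (hNF (ha σ τ x)))
    (fun k => ContinuousMonoidHom.ext fun x => apply_eq_of_mul_inv_mem k (ha1 x))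
    (fun _ _ _ => rfl)
    -- The cocycle identity is associativity: multiplied by `a (σ * τ * ρ) x`, both sides become the
    -- class of `a σ (a τ (a ρ x))`.
    (fun σ τ ρ => ContinuousMonoidHom.ext fun x => by
      refine Subtype.ext (mul_right_cancel (b := ((a (σ * τ * ρ) x : F) : F ⧸ frattiniStep p N)) ?_)
      simp only [ContinuousMonoidHom.mul_apply, Subgroup.coe_mul, hL, hR]
      rw [mul_assoc, mul_assoc σ τ ρ, hc, ← mul_assoc σ τ ρ, mul_assoc, hc, hc, ← mapQuotient_mk (p := p) (a σ) (haN σ),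
        coe_mapLayer, ← map_mul, hc, mapQuotient_mk])
  choose a' ha' using fun σ => hF.exists_mk_eq_mul hp (a σ) (b σ)
  have haa' (σ : Δ) (x : F) : a' σ x * (a σ x)⁻¹ ∈ N := by
    rw [← mk_mem_layer_iff (p := p) hN]
    simp [ha']
  refine ⟨a', haa', fun σ τ x => ?_⟩
  rw [mul_inv_mem_iff_mk_eq, ha', ha', hb,
    apply_eq_of_mul_inv_mem (b σ) (hNF (haa' τ x)), ← mapQuotient_mk (p := p) (a σ) (haN σ), ha',
    map_mul, mapQuotient_mk, ← hc]
  simp only [ContinuousMonoidHom.mul_apply, Subgroup.coe_mul, hL, hR, mul_assoc, coe_mapLayer]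

end Layer

/-! ### The descending series and its cofinality among open normal subgroups. -/

section Series

variable {p : ℕ} {F : Type u} [Group F] [TopologicalSpace F] [IsTopologicalGroup F]

/-- The iterates of `frattiniStep p` on `R`. -/
def frattiniSeries (p : ℕ) (R : Subgroup F) : ℕ → Subgroup F
  | 0 => R
  | n + 1 => frattiniStep p (frattiniSeries p R n)

variable {R : Subgroup F}

instance frattiniSeries_normal [hR : R.Normal] : ∀ n, (frattiniSeries p R n).Normal
  | 0 => hR
  | n + 1 => frattiniStep_normal (frattiniSeries p R n)

theorem isClosed_frattiniSeries (hR : IsClosed (R : Set F)) :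
    ∀ n, IsClosed (frattiniSeries p R n : Set F)
  | 0 => hR
  | _ + 1 => isClosed_frattiniStep _

theorem frattiniSeries_antitone [R.Normal] (hR : IsClosed (R : Set F)) :
    Antitone (frattiniSeries p R) :=
  antitone_nat_of_succ_le fun n => frattiniStep_le_self (isClosed_frattiniSeries hR n)

theorem apply_mem_frattiniSeries (f : F →ₜ* F) (hf : ∀ x ∈ R, f x ∈ R) :
    ∀ n, ∀ x ∈ frattiniSeries p R n, f x ∈ frattiniSeries p R n
  | 0 => hf
  | n + 1 => frattiniStep_le_comap f (apply_mem_frattiniSeries f hf n)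

variable [CompactSpace F] [TotallyDisconnectedSpace F]

/-- `V` is the preimage of a central subgroup of order `p` in the finite `p`-group `F ⧸ U`. This
drives the induction on the index: a term of the series inside `V` has its successor inside `U`. -/
theorem IsProP.exists_lt_pow_mem_commutator_mem (hp : p.Prime) (hF : IsProP p F) (U : Subgroup F)
    [U.Normal] (hU : IsOpen (U : Set F)) (hU' : U ≠ ⊤) :
    ∃ V : Subgroup F, V.Normal ∧ U < V ∧ (∀ n ∈ V, n ^ p ∈ U) ∧ ∀ n ∈ V, ∀ x, ⁅n, x⁆ ∈ U := by
  have : Fact p.Prime := ⟨hp⟩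
  have : Finite (F ⧸ U) := U.quotient_finite_of_isOpen hU
  have : Nontrivial (F ⧸ U) := QuotientGroup.nontrivial_iff.2 hU'
  obtain ⟨n, hn⟩ := hF U inferInstance hU
  have hQ : IsPGroup p (F ⧸ U) := IsPGroup.of_card hn
  have := hQ.center_nontrivial
  obtain ⟨k, hk, hk'⟩ := (hQ.to_subgroup (Subgroup.center _)).nontrivial_iff_card.1 this
  obtain ⟨⟨z, hz⟩, hzp⟩ := exists_prime_orderOf_dvd_card' (G := Subgroup.center (F ⧸ U)) p
    (hk' ▸ dvd_pow_self p hk.ne')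
  rw [Subgroup.orderOf_mk] at hzp
  have hle : Subgroup.zpowers z ≤ Subgroup.center (F ⧸ U) := by simpa using hz
  have hnorm : (Subgroup.zpowers z).Normal := ⟨fun y hy g => by
    rwa [Subgroup.mem_center_iff.1 (hle hy) g, mul_inv_cancel_right]⟩
  refine ⟨(Subgroup.zpowers z).comap (QuotientGroup.mk' U), hnorm.comap _, ?_, ?_, ?_⟩
  · refine lt_of_le_of_ne (fun x hx => ?_) fun h => ?_
    · have : QuotientGroup.mk' U x = 1 := (QuotientGroup.eq_one_iff x).2 hx
      rw [Subgroup.mem_comap, this]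
      exact one_mem _
    · obtain ⟨y, rfl⟩ := QuotientGroup.mk'_surjective U z
      have hy : y ∈ U := by rw [h]; exact Subgroup.mem_zpowers _
      rw [QuotientGroup.mk'_apply, (QuotientGroup.eq_one_iff y).2 hy, orderOf_one] at hzp
      exact hp.one_lt.ne hzp
  · rintro y ⟨m, hm⟩
    rw [← QuotientGroup.eq_one_iff, QuotientGroup.mk_pow, ← QuotientGroup.mk'_apply, ← hm]
    change (z ^ m) ^ p = 1
    rw [← zpow_natCast, zpow_comm, zpow_natCast, ← hzp, pow_orderOf_eq_one, one_zpow]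
  · intro y hy x
    rw [← QuotientGroup.eq_one_iff]
    exact commutatorElement_eq_one_iff_mul_comm.2 (Subgroup.mem_center_iff.1 (hle hy) x).symm

theorem IsProP.exists_frattiniSeries_le (hp : p.Prime) (hF : IsProP p F) (U : Subgroup F)
    (hUn : U.Normal) (hU : IsOpen (U : Set F)) : ∃ n, frattiniSeries p R n ≤ U := by
  induction h : U.index using Nat.strong_induction_on generalizing U with
  | _ k ih =>
    by_cases hU' : U = ⊤
    · exact ⟨0, hU' ▸ le_top⟩
    obtain ⟨V, hVn, hUV, hpow, hcomm⟩ := hF.exists_lt_pow_mem_commutator_mem hp U hU hU'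
    have : Finite (F ⧸ U) := U.quotient_finite_of_isOpen hU
    have : U.FiniteIndex := Subgroup.finiteIndex_of_finite_quotient
    obtain ⟨n, hn⟩ := ih _ (h ▸ Subgroup.index_strictAnti hUV) V hVn
      (Subgroup.isOpen_mono hUV.le hU) rfl
    exact ⟨n + 1, frattiniStep_le (U.isClosed_of_isOpen hU) (fun y hy => hpow y (hn hy))
      fun y hy => hcomm y (hn hy)⟩

end Series

/-! ### Limits of endomorphisms along a filtration. -/

section Limit

variable {F : Type u} [Group F] [TopologicalSpace F] [IsTopologicalGroup F]
  [CompactSpace F] [TotallyDisconnectedSpace F] {N : ℕ → Subgroup F}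

theorem eq_of_forall_mul_inv_mem
    (hU : ∀ U : Subgroup F, U.Normal → IsOpen (U : Set F) → ∃ n, N n ≤ U)
    {x y : F} (h : ∀ n, x * y⁻¹ ∈ N n) : x = y := by
  rw [← mul_inv_eq_one]
  by_contra hx
  obtain ⟨U, hUn, hUo, hxU⟩ := exists_normal_isOpen_notMem hx
  obtain ⟨n, hn⟩ := hU U hUn hUo
  exact hxU (hn (h n))

/-- A sequence of endomorphisms that is Cauchy along a filtration shrinking to `1` converges. -/
theorem exists_limit_hom [∀ n, (N n).Normal] (hN : Antitone N)
    (hNc : ∀ n, IsClosed (N n : Set F))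
    (hU : ∀ U : Subgroup F, U.Normal → IsOpen (U : Set F) → ∃ n, N n ≤ U)
    (f : ℕ → F →ₜ* F) (hf : ∀ n x, f (n + 1) x * (f n x)⁻¹ ∈ N n) :
    ∃ g : F →ₜ* F, ∀ n x, g x * (f n x)⁻¹ ∈ N n := by
  -- The cosets of `N n` through `f n x` are nested, nonempty and compact.
  have hg (x : F) : ∃ y, ∀ n, y * (f n x)⁻¹ ∈ N n := by
    have hcl (n : ℕ) : IsClosed {y | y * (f n x)⁻¹ ∈ N n} :=
      (hNc n).preimage (continuous_mul_const _)
    obtain ⟨y, hy⟩ := IsCompact.nonempty_iInter_of_sequence_nonempty_isCompact_isClosed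
      (fun n => {y | y * (f n x)⁻¹ ∈ N n})
      (fun n y hy => by
        have := (N n).mul_mem (hN n.le_succ hy) (hf n x)
        rwa [mul_assoc, inv_mul_cancel_left] at this)
      (fun n => ⟨f n x, by simp [(N n).one_mem]⟩) (hcl 0).isCompact hcl
    exact ⟨y, fun n => Set.mem_iInter.1 hy n⟩
  choose g hg using hg
  have hmul (x y : F) : g (x * y) = g x * g y := eq_of_forall_mul_inv_mem hU fun n => by
    have h := hg (x * y) n
    have hx := hg x n
    have hy := hg y n
    rw [mul_inv_mem_iff_mk_eq] at h hx hy ⊢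
    rw [h, map_mul, QuotientGroup.mk_mul, QuotientGroup.mk_mul, hx, hy]
  let g' : F →* F := MonoidHom.mk' g hmul
  refine ⟨⟨g', continuous_of_continuousAt_one g' fun W hW => ?_⟩, fun n x => hg x n⟩
  rw [map_one] at hW
  obtain ⟨U, hUn, hUo, hUW⟩ := exists_normal_isOpen_le_of_mem_nhds hW
  obtain ⟨n, hn⟩ := hU U hUn hUo
  have h1 : f n ⁻¹' U ∈ 𝓝 (1 : F) :=
    (hUo.preimage (f n).continuous_toFun).mem_nhds (by simp [U.one_mem])
  rw [mem_map]
  filter_upwards [h1] with x hx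
  refine hUW ?_
  have := U.mul_mem (hn (hg x n)) hx
  rwa [inv_mul_cancel_right] at this

end Limit

/-! ### Passage to the limit and the resulting action. -/

section Action

variable {p : ℕ} {F : Type u} [Group F] [TopologicalSpace F] [IsTopologicalGroup F]
  [CompactSpace F] [TotallyDisconnectedSpace F] {R : Subgroup F} [R.Normal]

theorem IsFreeProP.exists_multiplicative_lift (hp : p.Prime) (hF : IsFreeProP p F)
    (hR : IsClosed (R : Set F)) (hRF : R ≤ proPFrattini p F) {Δ : Type*} [Group Δ] [Finite Δ]
    (hΔ : (Nat.card Δ).Coprime p) (a : Δ → F →ₜ* F) (haR : ∀ σ, ∀ x ∈ R, a σ x ∈ R)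
    (ha1 : ∀ x, a 1 x * x⁻¹ ∈ R) (ha : ∀ σ τ x, a σ (a τ x) * (a (σ * τ) x)⁻¹ ∈ R) :
    ∃ b : Δ → F →ₜ* F, (∀ σ x, b σ x * (a σ x)⁻¹ ∈ R) ∧ (∀ x, b 1 x = x) ∧
      ∀ σ τ x, b σ (b τ x) = b (σ * τ) x := by
  let N := frattiniSeries p R
  have hN : Antitone N := frattiniSeries_antitone hR
  have hNc (n : ℕ) : IsClosed (N n : Set F) := isClosed_frattiniSeries hR n
  have hNU (U : Subgroup F) (hUn : U.Normal) (hUo : IsOpen (U : Set F)) : ∃ n, N n ≤ U :=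
    hF.1.exists_frattiniSeries_le hp U hUn hUo
  have hNn (n : ℕ) : (N n).Normal := frattiniSeries_normal n
  have hNF (n : ℕ) : N n ≤ proPFrattini p F := (hN n.zero_le).trans hRF
  let IsLift (n : ℕ) (b : Δ → F →ₜ* F) : Prop :=
    (∀ σ x, b σ x * (a σ x)⁻¹ ∈ R) ∧ ∀ σ τ x, b σ (b τ x) * (b (σ * τ) x)⁻¹ ∈ N n
  have hbR {b : Δ → F →ₜ* F} (hb : ∀ σ x, b σ x * (a σ x)⁻¹ ∈ R) (σ : Δ) (x : F) (hx : x ∈ R) :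
      b σ x ∈ R := by
    simpa using R.mul_mem (hb σ x) (haR σ x hx)
  have hb1 {b : Δ → F →ₜ* F} (hb : ∀ σ x, b σ x * (a σ x)⁻¹ ∈ R) (x : F) : b 1 x * x⁻¹ ∈ R := by
    simpa [mul_assoc] using R.mul_mem (hb 1 x) (ha1 x)
  have hstep (n : ℕ) (b : {b // IsLift n b}) : ∃ b' : {b // IsLift (n + 1) b},
      ∀ σ x, b'.1 σ x * (b.1 σ x)⁻¹ ∈ N n := by
    obtain ⟨b, hba, hb⟩ := b
    obtain ⟨b', hb'b, hb'⟩ := hF.exists_lift_action_step hp (hNc n) (hNF n) hΔ b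
      (fun σ => apply_mem_frattiniSeries (b σ) (hbR hba σ) n) (fun x => hRF (hb1 hba x)) hb
    refine ⟨⟨b', fun σ x => ?_, hb'⟩, hb'b⟩
    simpa [mul_assoc] using R.mul_mem (hN n.zero_le (hb'b σ x)) (hba σ x)
  choose next hnext using hstep
  let s : (n : ℕ) → {b // IsLift n b} := fun n =>
    Nat.rec ⟨a, fun σ x => by simp [R.one_mem], ha⟩ next n
  have hs (n : ℕ) (σ : Δ) (x : F) : (s (n + 1)).1 σ x * ((s n).1 σ x)⁻¹ ∈ N n := hnext n (s n) σ x
  choose b hb using fun σ => exists_limit_hom hN hNc hNU (fun n => (s n).1 σ) (fun n => hs n σ)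
  have hba (σ : Δ) (x : F) : b σ x * (a σ x)⁻¹ ∈ R := hb σ 0 x
  have hmul (σ τ : Δ) (x : F) : b σ (b τ x) = b (σ * τ) x :=
    eq_of_forall_mul_inv_mem hNU fun n => by
      have h1 := hb σ n (b τ x)
      have h2 := apply_mem_frattiniSeries (p := p) ((s n).1 σ) (hbR (s n).2.1 σ) n _ (hb τ n x)
      have h3 := (s n).2.2 σ τ x
      have h4 := hb (σ * τ) n x
      change _ ∈ N n at h2
      rw [map_mul, map_inv] at h2
      rw [mul_inv_mem_iff_mk_eq] at h1 h2 h3 h4 ⊢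
      rw [h1, h2, h3, h4]
  -- Multiplicativity alone only makes `b 1` idempotent. If `b 1` is the identity modulo `N n`, the
  -- difference `d` kills the Frattini subgroup, so `d x = d (b 1 x)`, which is trivial by
  -- idempotence; hence the congruence improves to `N (n + 1)`.
  refine ⟨b, hba, fun x => eq_of_forall_mul_inv_mem hNU fun n => ?_, hmul⟩
  induction n generalizing x with
  | zero => exact hb1 hba x
  | succ n ih =>
    let d := diffHom p (b 1) (ContinuousMonoidHom.id F) ih
    have hd (x : F) : (d x : F ⧸ frattiniStep p (N n)) = (b 1 x * x⁻¹ : F) := rfl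
    rw [← QuotientGroup.eq_one_iff (N := N (n + 1))]
    change ((b 1 x * x⁻¹ : F) : F ⧸ frattiniStep p (N n)) = 1
    rw [← hd, ← apply_eq_of_mul_inv_mem d (hNF n (ih x)), hd, hmul, mul_one, mul_inv_cancel,
      QuotientGroup.mk_one]

end Action

theorem lemma1p2 (p : ℕ) (hp : p.Prime)
    {F : Type u} [Group F] [TopologicalSpace F] [IsTopologicalGroup F] [CompactSpace F]
    [TotallyDisconnectedSpace F]
    {G : Type v} [Group G] [TopologicalSpace G] [IsTopologicalGroup G] [CompactSpace G]
    [TotallyDisconnectedSpace G] (hG : IsProP p G)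
    (π : F →ₜ* G) (hπ : IsMinimalProPPresentation p π)
    {Δ : Type w} [Group Δ] [Finite Δ] [TopologicalSpace Δ] [DiscreteTopology Δ]
    (hΔ : (Nat.card Δ).Coprime p)
    [MulDistribMulAction Δ G] [ContinuousSMul Δ G] :
    ∃ _ : MulDistribMulAction Δ F, ContinuousSMul Δ F ∧
      ∀ (σ : Δ) (x : F), π (σ • x) = σ • π x := by
  have hker {x y : F} : x * y⁻¹ ∈ π.toMonoidHom.ker ↔ π x = π y := by
    change π (x * y⁻¹) = 1 ↔ _
    rw [map_mul, map_inv, mul_inv_eq_one]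
  -- Each `a σ` lifts `σ ∘ π` through `π`.
  choose a ha using fun σ : Δ => hπ.free.exists_lift hp
    (ContinuousMonoidHom.comp ⟨MulDistribMulAction.toMonoidHom G σ, continuous_const_smul σ⟩ π) π
    hπ.surjective
  replace ha (σ : Δ) (x : F) : π (a σ x) = σ • π x := ha σ x
  obtain ⟨b, hba, hb1, hb⟩ := hπ.free.exists_multiplicative_lift hp
    (isClosed_singleton.preimage π.continuous_toFun) hπ.ker_le hΔ a
    (fun σ x hx => by
      have hx' : π x = 1 := hx
      change π (a σ x) = 1
      rw [ha, hx', smul_one])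
    (fun x => hker.2 (by rw [ha, one_smul]))
    (fun σ τ x => hker.2 (by rw [ha, ha, ha, mul_smul]))
  let act : MulDistribMulAction Δ F :=
    { smul σ x := b σ x
      one_smul := hb1
      mul_smul σ τ x := (hb σ τ x).symm
      smul_mul σ x y := map_mul (b σ) x y
      smul_one σ := map_one (b σ) }
  refine ⟨act, ⟨continuous_prod_of_discrete_left.2 fun σ => (b σ).continuous_toFun⟩, fun σ x => ?_⟩
  rw [← ha]
  exact hker.1 (hba σ x)
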